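/- Write $Q_I=\operatorname{conv}(Q\cap\mathbb{Z}^2)$ for the integer hull of a set $Q\subseteq\mathbb{R}^2$. Let $P=\{x\in\mathbb{R}^2: Ax\le b\}$ be a rational polyhedron ($A\in\mathbb{Z}^{m\times 2}$, $b\in\mathbb{Z}^m$) of dimension two that is not a closed half-plane. For a facet $F$ of $P$ let $H_F$ denote the facet-defining half-plane of $F$, i.e. the closed half-plane that contains $P$ and whose boundary line contains $F$. Then, for any two distinct facets $F_1\ne F_2$ of $P$, the set $H_{F_1}\cap H_{F_2}$ is either a simplicial cone (the intersection of two half-planes with linearly independent normals) or a full-dimensional strip between two parallel lines, and $$P_I=\bigcap_{\substack{F_1,F_2\text{ facets of }P\\ F_1\neq F_2}}\bigl(H_{F_1}\cap H_{F_2}\bigr)_I ,$$ where the intersection is understood to be $\mathbb{R}^2$ if $P=\mathbb{R}^2$ (no facets). This holds whether or not $P$ contains an integer point; in particular, if $P\cap\mathbb{Z}^2=\emptyset$, the intersection on the right is empty. -/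

import Mathlib

namespace PlaneHull

/-- The points of `ℝⁿ` all of whose coordinates are integers. -/
def integerPoints (n : ℕ) : Set (EuclideanSpace ℝ (Fin n)) :=
  {x | ∀ i, ∃ k : ℤ, x i = (k : ℝ)}

/-- The integer hull `conv (P ∩ ℤⁿ)`. -/
def integerHull {n : ℕ} (P : Set (EuclideanSpace ℝ (Fin n))) :
    Set (EuclideanSpace ℝ (Fin n)) :=
  convexHull ℝ (P ∩ integerPoints n)

/-- A rational polyhedron `{x | A x ≤ b}`, with `A` an integral matrix and `b` an integral
vector; there may be no rows at all, and rows may be redundant. -/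
def IsRationalPolyhedron {n : ℕ} (P : Set (EuclideanSpace ℝ (Fin n))) : Prop :=
  ∃ (m : ℕ) (A : Matrix (Fin m) (Fin n) ℤ) (b : Fin m → ℤ),
    P = {x | ∀ i, ∑ j, (A i j : ℝ) * x j ≤ (b i : ℝ)}

/-- The dimension of a set: the dimension of its affine hull (the empty set gets `0`). -/
noncomputable def dimension {n : ℕ} (P : Set (EuclideanSpace ℝ (Fin n))) : ℕ :=
  Module.finrank ℝ (vectorSpan ℝ P)

/-- A closed halfspace, bounded by a genuine hyperplane. -/
def IsHalfspace {n : ℕ} (H : Set (EuclideanSpace ℝ (Fin n))) : Prop :=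
  ∃ (a : EuclideanSpace ℝ (Fin n)) (b : ℝ), a ≠ 0 ∧ H = {x | inner ℝ a x ≤ b}

/-- A facet: a nonempty face whose dimension is one less than that of `P`. -/
def IsFacet {n : ℕ} (P F : Set (EuclideanSpace ℝ (Fin n))) : Prop :=
  IsExposed ℝ P F ∧ F.Nonempty ∧ dimension F + 1 = dimension P

/-- `H` is a closed halfspace that contains `P` and whose bounding hyperplane cuts `P`
exactly in `F`. If `P` is full-dimensional and `F` is a facet of `P`, there is exactly one
such `H`, the facet-defining halfspace of `F`. -/
def Defines {n : ℕ} (P F H : Set (EuclideanSpace ℝ (Fin n))) : Prop :=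
  ∃ (a : EuclideanSpace ℝ (Fin n)) (b : ℝ), a ≠ 0 ∧ H = {x | inner ℝ a x ≤ b} ∧
    P ⊆ H ∧ F = P ∩ {x | inner ℝ a x = b}

/-- The sets `H₁ ∩ H₂`, where `H₁` and `H₂` are the facet-defining halfspaces of two
different facets of `P`. -/
def facetPairRelaxations {n : ℕ} (P : Set (EuclideanSpace ℝ (Fin n))) :
    Set (Set (EuclideanSpace ℝ (Fin n))) :=
  {Q | ∃ F₁ F₂ H₁ H₂ : Set (EuclideanSpace ℝ (Fin n)),
    IsFacet P F₁ ∧ IsFacet P F₂ ∧ F₁ ≠ F₂ ∧ Defines P F₁ H₁ ∧ Defines P F₂ H₂ ∧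
    Q = H₁ ∩ H₂}

/-- A simplicial cone in `ℝⁿ` (with arbitrary apex): the solution set of `n` linear
inequalities with linearly independent normal vectors. -/
def IsSimplicialCone {n : ℕ} (Q : Set (EuclideanSpace ℝ (Fin n))) : Prop :=
  ∃ (a : Fin n → EuclideanSpace ℝ (Fin n)) (b : Fin n → ℝ), LinearIndependent ℝ a ∧
    Q = {x | ∀ i, inner ℝ (a i) x ≤ b i}

/-- A full-dimensional strip between two parallel hyperplanes. -/
def IsStrip {n : ℕ} (Q : Set (EuclideanSpace ℝ (Fin n))) : Prop :=
  ∃ (a : EuclideanSpace ℝ (Fin n)) (b c : ℝ), a ≠ 0 ∧ b < c ∧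
    Q = {x | b ≤ inner ℝ a x ∧ inner ℝ a x ≤ c}

end PlaneHull

namespace PlaneHull

/-! One inclusion is monotonicity of the hull. For the other, the rows of an irredundant description
of `P` define distinct facets, so it suffices that pairs determine the integer hull of an
intersection of at least two half-planes (`mem_integerHull_iInter_of_pairs`). Induction reduces this
to three sets `A₁`, `A₂`, `A₃` inside a convex `C` (`mem_integerHull_inter_three`).

Let `S` be the set of lattice points common to all of them, and let `x` lie in the three pairwise
hulls but not in the hull of `S`. If `x` sees an edge `pq` of that hull, each pairwise intersection
has a lattice point beyond `pq`, hence one on the first lattice line beyond `pq`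
(`exists_first_lattice_line`). The middle one of these three collinear points lies, by convexity,
also in the set its own pair omits. So it belongs to `S`, although it is beyond `pq`. Otherwise `S`
is empty or on a ray pointing away from `x`, which convexity of the sets and of their complements
excludes. -/

/-! ### Visibility from a point outside a finite hull -/

/-- Twice the signed area of the triangle `p q z`. -/
def orient (p q z : EuclideanSpace ℝ (Fin 2)) : ℝ :=
  (q 0 - p 0) * (z 1 - p 1) - (q 1 - p 1) * (z 0 - p 0)

lemma exists_extreme_from_outside {S : Set (EuclideanSpace ℝ (Fin 2))} (hS : S.Finite)
    (hne : S.Nonempty) {x : EuclideanSpace ℝ (Fin 2)} (hx : x ∉ convexHull ℝ S) :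
    ∃ p ∈ S, ∀ s ∈ S, orient p x s < 0 ∨ ∃ τ : ℝ, 0 ≤ τ ∧ s = p - τ • (x - p) := by
  obtain ⟨f, u, hf, hu⟩ := geometric_hahn_banach_closed_point (convex_convexHull ℝ S)
    (hS.isClosed_convexHull ℝ) hx
  set c := (InnerProductSpace.toDual ℝ _).symm f with hc
  have hfc : ∀ z, f z = c 0 * z 0 + c 1 * z 1 := by
    intro z
    rw [← InnerProductSpace.toDual_symm_apply, ← hc, PiLp.inner_apply, Fin.sum_univ_two]
    simp [mul_comm]
  -- Up to a common factor, `h s` and `w s` are the coordinates of `s - x` along `-c` and across it.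
  -- The point of tangency seen from `x` maximises the slope `w / h`; ties go to the point nearest
  -- to `x`.
  set h : EuclideanSpace ℝ (Fin 2) → ℝ := fun s => c 0 * (x 0 - s 0) + c 1 * (x 1 - s 1) with hh
  set w : EuclideanSpace ℝ (Fin 2) → ℝ := fun s => c 0 * (s 1 - x 1) - c 1 * (s 0 - x 0) with hw
  have hpos : ∀ s ∈ S, 0 < h s := by
    intro s hs
    have h1 := hf s (subset_convexHull ℝ S hs)
    rw [hfc] at h1 hu
    simp only [hh]; nlinarith
  have hcc : 0 < c 0 ^ 2 + c 1 ^ 2 := by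
    obtain ⟨s, hs⟩ := hne
    have h1 := hpos s hs
    by_contra hcon
    have h0 : c 0 = 0 := by nlinarith [sq_nonneg (c 0), sq_nonneg (c 1)]
    have h2 : c 1 = 0 := by nlinarith [sq_nonneg (c 0), sq_nonneg (c 1)]
    simp [hh, h0, h2] at h1
  obtain ⟨p₀, hp₀, hmax⟩ := Set.exists_max_image S (fun s => w s / h s) hS hne
  obtain ⟨p, ⟨hpS, hpeq⟩, hmin⟩ := Set.exists_min_image {s ∈ S | w s / h s = w p₀ / h p₀} h
    (hS.subset (Set.sep_subset _ _)) ⟨p₀, hp₀, rfl⟩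
  refine ⟨p, hpS, fun s hs => ?_⟩
  have hid : (c 0 ^ 2 + c 1 ^ 2) * orient p x s = w s * h p - w p * h s := by
    simp only [orient, hh, hw]; ring
  have hle : w s / h s ≤ w p / h p := by rw [hpeq]; exact hmax s hs
  rcases hle.lt_or_eq with hlt | heq
  · left
    rw [div_lt_div_iff₀ (hpos s hs) (hpos p hpS)] at hlt
    by_contra hcon
    nlinarith
  · right
    have hm := hmin s ⟨hs, by rw [heq, hpeq]⟩
    rw [div_eq_div_iff (hpos s hs).ne' (hpos p hpS).ne'] at heq
    have hp := hpos p hpS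
    refine ⟨h s / h p - 1, by rw [sub_nonneg, one_le_div hp]; exact hm, ?_⟩
    have e1 : (c 0 ^ 2 + c 1 ^ 2) * (h p * (s 0 - x 0) - h s * (p 0 - x 0)) =
        - c 1 * (w s * h p - w p * h s) := by
      simp only [hh, hw]; ring
    have e2 : (c 0 ^ 2 + c 1 ^ 2) * (h p * (s 1 - x 1) - h s * (p 1 - x 1)) =
        c 0 * (w s * h p - w p * h s) := by
      simp only [hh, hw]; ring
    rw [heq, sub_self, mul_zero] at e1 e2
    have e3 := (mul_eq_zero.1 e1).resolve_left hcc.ne'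
    have e4 := (mul_eq_zero.1 e2).resolve_left hcc.ne'
    ext i
    fin_cases i
    · simp only [Fin.zero_eta, PiLp.sub_apply, PiLp.smul_apply, smul_eq_mul]
      field_simp
      linarith
    · simp only [Fin.mk_one, PiLp.sub_apply, PiLp.smul_apply, smul_eq_mul]
      field_simp
      linarith

/-- A point outside the hull of a finite set `S` either sees an edge of that hull, or `S` lies on
a ray pointing away from the point. -/
lemma exists_ray_or_visible_edge {S : Set (EuclideanSpace ℝ (Fin 2))} (hS : S.Finite)
    (hne : S.Nonempty) {x : EuclideanSpace ℝ (Fin 2)} (hx : x ∉ convexHull ℝ S) :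
    (∃ p ∈ S, ∀ s ∈ S, ∃ τ : ℝ, 0 ≤ τ ∧ s = p - τ • (x - p)) ∨
      ∃ p ∈ S, ∃ q ∈ S, 0 < orient p q x ∧ ∀ s ∈ S, orient p q s ≤ 0 := by
  obtain ⟨p, hp, hps⟩ := exists_extreme_from_outside hS hne hx
  by_cases hall : ∀ s ∈ S, ∃ τ : ℝ, 0 ≤ τ ∧ s = p - τ • (x - p)
  · exact Or.inl ⟨p, hp, hall⟩
  right
  push Not at hall
  obtain ⟨s₀, hs₀, hs₀'⟩ := hall
  have hs₀K : orient p x s₀ < 0 := by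
    rcases hps s₀ hs₀ with h | ⟨τ, h1, h2⟩
    · exact h
    · exact absurd h2 (hs₀' τ h1)
  -- `d s / (-orient p x s)` is the cotangent of the angle at `p` between `x` and `s`. Its maximiser
  -- `q` makes the smallest angle, so all of `S` is on the far side of the line `pq`.
  set d : EuclideanSpace ℝ (Fin 2) → ℝ :=
    fun s => (x 0 - p 0) * (s 0 - p 0) + (x 1 - p 1) * (s 1 - p 1) with hd
  obtain ⟨q, ⟨hq, hqK⟩, hmax⟩ := Set.exists_max_image {s ∈ S | orient p x s < 0}
    (fun s => d s / (-orient p x s)) (hS.subset (Set.sep_subset _ _)) ⟨s₀, hs₀, hs₀K⟩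
  have hqx : orient p q x = -orient p x q := by simp only [orient]; ring
  refine ⟨p, hp, q, hq, by linarith, fun s hs => ?_⟩
  rcases hps s hs with hsK | ⟨τ, h1, h2⟩
  · have hle := hmax s ⟨hs, hsK⟩
    rw [div_le_div_iff₀ (by linarith) (by linarith)] at hle
    have hid : ((x 0 - p 0) ^ 2 + (x 1 - p 1) ^ 2) * orient p q s =
        d q * orient p x s - orient p x q * d s := by
      simp only [orient, hd]; ring
    have hpos : 0 < (x 0 - p 0) ^ 2 + (x 1 - p 1) ^ 2 := by
      by_contra hcon
      have h0 : x 0 - p 0 = 0 := by nlinarith [sq_nonneg (x 0 - p 0), sq_nonneg (x 1 - p 1)]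
      have h2 : x 1 - p 1 = 0 := by nlinarith [sq_nonneg (x 0 - p 0), sq_nonneg (x 1 - p 1)]
      simp [orient, h0, h2] at hqK
    by_contra hcon
    push Not at hcon
    nlinarith [mul_pos hpos hcon]
  · have : orient p q s = -τ * orient p q x := by
      rw [h2]; simp only [orient, PiLp.sub_apply, PiLp.smul_apply, smul_eq_mul]; ring
    rw [this]
    nlinarith

/-! ### Lattice points beyond an edge -/

/-- Over an edge with lattice endpoints, each lattice triangle has a lattice point on the first
lattice line beyond the edge. -/
lemma exists_first_lattice_line {p q : EuclideanSpace ℝ (Fin 2)} (hp : p ∈ integerPoints 2)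
    (hq : q ∈ integerPoints 2) (hpq : p ≠ q) :
    ∃ w v : EuclideanSpace ℝ (Fin 2), (∀ t : ℝ, 0 < orient p q (w + t • v)) ∧
      ∀ n ∈ integerPoints 2, 0 < orient p q n →
        ∃ t : ℝ, w + t • v ∈ integerPoints 2 ∧ w + t • v ∈ convexHull ℝ {p, q, n} := by
  obtain ⟨p0, hp0⟩ := hp 0
  obtain ⟨p1, hp1⟩ := hp 1
  obtain ⟨q0, hq0⟩ := hq 0
  obtain ⟨q1, hq1⟩ := hq 1
  have hg : 0 < Int.gcd (q0 - p0) (q1 - p1) := by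
    rw [Int.gcd_pos_iff]
    by_contra hcon
    push Not at hcon
    apply hpq
    ext i
    fin_cases i
    · simp only [Fin.zero_eta, hp0, hq0]; norm_cast; linarith [hcon.1]
    · simp only [Fin.mk_one, hp1, hq1]; norm_cast; linarith [hcon.2]
  obtain ⟨g, u, v, hgpos, hcop, h0, h1⟩ := Int.exists_gcd_one' hg
  obtain ⟨s, t, hst⟩ := Int.isCoprime_iff_gcd_eq_one.2 hcop
  have hgR : (0 : ℝ) < g := by exact_mod_cast hgpos
  have hg1 : (1 : ℝ) ≤ g := by exact_mod_cast hgpos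
  have h0R : (q0 : ℝ) - p0 = u * g := by exact_mod_cast h0
  have h1R : (q1 : ℝ) - p1 = v * g := by exact_mod_cast h1
  have hstR : (s : ℝ) * u + t * v = 1 := by exact_mod_cast hst
  -- By Bézout, `(u, v)` and `(-t, s)` form a lattice basis. Below, `X` and `Y` are the coordinates
  -- of `n - p` in it, and the line chosen is `Y = 1`.
  refine ⟨p + !₂[-(t : ℝ), (s : ℝ)], !₂[(u : ℝ), (v : ℝ)], fun r => ?_, fun n hn hpos => ?_⟩
  · have : orient p q (p + !₂[-(t : ℝ), (s : ℝ)] + r • !₂[(u : ℝ), (v : ℝ)]) = g := by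
      simp [orient, hp0, hp1, hq0, hq1, h0R, h1R]
      linear_combination (g : ℝ) * hstR
    rw [this]; exact hgR
  obtain ⟨n0, hn0⟩ := hn 0
  obtain ⟨n1, hn1⟩ := hn 1
  set Y : ℤ := u * (n1 - p1) - v * (n0 - p0) with hY
  set X : ℤ := s * (n0 - p0) + t * (n1 - p1) with hX
  have hYpos : 0 < Y := by
    have : orient p q n = g * (Y : ℝ) := by
      simp only [orient, hp0, hp1, hq0, hq1, h0R, h1R, hn0, hn1, hY]; push_cast; ring
    rw [this] at hpos
    exact_mod_cast (mul_pos_iff_of_pos_left hgR).1 hpos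
  have hYR : (1 : ℝ) ≤ Y := by exact_mod_cast hYpos
  -- `R` is `X / Y` rounded up. At height one the triangle starts at `X / Y` and has width `g * (1 -
  -- 1 / Y)`, at least the `1 - 1 / Y` by which rounding up a fraction with denominator `Y` can move
  -- it.
  set R : ℤ := -((-X) / Y) with hR
  have hm1 := Int.emod_add_mul_ediv (-X) Y
  have hm2 := Int.emod_nonneg (-X) hYpos.ne'
  have hm3 := Int.emod_lt_of_pos (-X) hYpos
  have hRX : (X : ℝ) ≤ R * Y := by exact_mod_cast (by rw [hR]; linarith : X ≤ R * Y)
  have hRX' : (R : ℝ) * Y ≤ X + Y - 1 := by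
    exact_mod_cast (by rw [hR]; linarith : R * Y ≤ X + Y - 1)
  refine ⟨R, ?_, ?_⟩
  · intro i
    fin_cases i
    · exact ⟨p0 - t + R * u, by simp [hp0]; ring⟩
    · exact ⟨p1 + s + R * v, by simp [hp1]⟩
  · set γ : ℝ := 1 / Y with hγ
    set β : ℝ := (R * Y - X) / (Y * g) with hβ
    have hYpos' : (0 : ℝ) < Y := by linarith
    have hβ0 : 0 ≤ β := div_nonneg (by linarith) (by positivity)
    have hγ0 : 0 ≤ γ := by positivity
    have hβγ : β + γ ≤ 1 := by
      have : β ≤ (R * Y - X) / Y := by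
        apply div_le_div_of_nonneg_left (by linarith) hYpos'
        nlinarith
      have h2 : (R * Y - X) / Y + 1 / Y ≤ (1 : ℝ) := by
        rw [← add_div, div_le_one hYpos']; linarith
      linarith
    have hsum : p + !₂[-(t : ℝ), (s : ℝ)] + (R : ℝ) • !₂[(u : ℝ), (v : ℝ)] =
        (1 - β - γ) • p + β • q + γ • n := by
      have hn0' : (n0 : ℝ) - p0 = X * u - Y * t := by
        simp only [hX, hY]; push_cast; linear_combination (-(n0 : ℝ) + p0) * hstR
      have hn1' : (n1 : ℝ) - p1 = X * v + Y * s := by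
        simp only [hX, hY]; push_cast; linear_combination (-(n1 : ℝ) + p1) * hstR
      have hβg : β * g = R - X / Y := by rw [hβ]; field_simp
      have hγY : γ * Y = 1 := by rw [hγ]; field_simp
      have hXγ : X / Y = X * γ := by rw [hγ]; ring
      rw [hXγ] at hβg
      ext i
      fin_cases i
      · simp [hp0, hq0, hn0]
        linear_combination (-γ) * hn0' - β * h0R - u * hβg + t * hγY
      · simp [hp1, hq1, hn1]
        linear_combination (-γ) * hn1' - β * h1R - v * hβg - s * hγY
    rw [hsum]
    have hsub := subset_convexHull ℝ ({p, q, n} : Set (EuclideanSpace ℝ (Fin 2)))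
    have := (convex_convexHull ℝ ({p, q, n} : Set (EuclideanSpace ℝ (Fin 2)))).sum_mem
      (t := Finset.univ) (w := ![1 - β - γ, β, γ]) (z := ![p, q, n])
      (by intro i _; fin_cases i <;> simp <;> linarith)
      (by simp [Fin.sum_univ_three]; ring)
      (by intro i _; fin_cases i <;> simp <;> apply hsub <;> simp)
    simpa [Fin.sum_univ_three] using this

/-! ### Three convex sets -/

/-- `x` is a mixture of a point of the hull of `S`, at or behind `p`, and a point of the hull of `K
\ S`; the latter must then lie at or past `x` on the same line. -/
lemma exists_mem_convexHull_diff_on_ray {E : Type*} [AddCommGroup E] [Module ℝ E] {S K : Set E}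
    {x p : E} (hSK : S ⊆ K) (hxK : x ∈ convexHull ℝ K) (hxS : x ∉ convexHull ℝ S)
    (hray : ∀ s ∈ S, ∃ τ : ℝ, 0 ≤ τ ∧ s = p - τ • (x - p)) :
    ∃ r : ℝ, 1 ≤ r ∧ p + r • (x - p) ∈ convexHull ℝ (K \ S) := by
  rcases S.eq_empty_or_nonempty with rfl | hne
  · exact ⟨1, le_rfl, by simpa using hxK⟩
  have hne' : (K \ S).Nonempty := by
    rw [Set.nonempty_iff_ne_empty]
    intro h
    exact hxS (convexHull_mono (Set.sdiff_eq_empty.1 h) hxK)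
  rw [← Set.union_sdiff_cancel hSK, convexHull_union hne hne', mem_convexJoin] at hxK
  obtain ⟨σ, hσ, z, hz, a, b, ha, hb, hab, hx⟩ := hxK
  have hconv : Convex ℝ {y : E | ∃ τ : ℝ, 0 ≤ τ ∧ y = p - τ • (x - p)} := by
    rintro _ ⟨τ, hτ, rfl⟩ _ ⟨τ', hτ', rfl⟩ c d hc hd hcd
    refine ⟨c * τ + d * τ', by positivity, ?_⟩
    obtain rfl : d = 1 - c := by linarith
    module
  obtain ⟨τ, hτ, hστ⟩ := convexHull_min hray hconv hσ
  have hb0 : b ≠ 0 := by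
    rintro rfl
    apply hxS
    have ha1 : a = 1 := by linarith
    rw [← hx, ha1]
    simpa using hσ
  have hbpos : 0 < b := lt_of_le_of_ne hb hb0.symm
  refine ⟨(1 + a * τ) / b, ?_, ?_⟩
  · rw [one_le_div hbpos]; nlinarith [mul_nonneg ha hτ]
  · have hz' : p + ((1 + a * τ) / b) • (x - p) = z := by
      have hbz : b • z = x - a • (p - τ • (x - p)) := by rw [← hστ, ← hx]; abel
      have : b • (p + ((1 + a * τ) / b) • (x - p)) = b • z := by
        rw [hbz, smul_add, smul_smul, mul_div_cancel₀ _ hb0]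
        obtain rfl : b = 1 - a := by linarith
        module
      exact smul_right_injective E hb0 this
    rw [hz']; exact hz

lemma finite_integerPoints_inter_closedBall (r : ℝ) :
    (integerPoints 2 ∩ Metric.closedBall 0 r).Finite := by
  have hfin : ((fun k : ℤ × ℤ => !₂[(k.1 : ℝ), (k.2 : ℝ)]) ''
      (Set.Icc (-⌈r⌉) ⌈r⌉ ×ˢ Set.Icc (-⌈r⌉) ⌈r⌉)).Finite :=
    ((Set.finite_Icc _ _).prod (Set.finite_Icc _ _)).image _
  refine hfin.subset ?_
  rintro z ⟨hz, hzr⟩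
  have hb : ∀ i, ∀ k : ℤ, z i = k → k ∈ Set.Icc (-⌈r⌉) ⌈r⌉ := by
    intro i k hk
    have h1 : |z i| ≤ r := by
      have := PiLp.norm_apply_le z i
      rw [mem_closedBall_zero_iff] at hzr
      exact this.trans hzr
    rw [hk] at h1
    have h2 : |(k : ℝ)| ≤ (⌈r⌉ : ℝ) := h1.trans (Int.le_ceil r)
    rw [Set.mem_Icc, ← abs_le]
    exact_mod_cast h2
  obtain ⟨k0, h0⟩ := hz 0
  obtain ⟨k1, h1⟩ := hz 1
  refine ⟨(k0, k1), ⟨hb 0 k0 h0, hb 1 k1 h1⟩, ?_⟩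
  ext i
  fin_cases i <;> simp [h0, h1]

lemma convex_orient_nonpos (p q : EuclideanSpace ℝ (Fin 2)) :
    Convex ℝ {z | orient p q z ≤ 0} := by
  intro y hy z hz a b ha hb hab
  have : orient p q (a • y + b • z) = a * orient p q y + b * orient p q z := by
    obtain rfl : b = 1 - a := by linarith
    simp [orient]; ring
  simp only [Set.mem_ofPred_eq] at *
  rw [this]
  nlinarith

/-- One of three points on a line lies between the two others. -/
lemma exists_between_of_three {E : Type*} [AddCommGroup E] [Module ℝ E] (w v : E) (a b c : ℝ) :
    w + a • v ∈ segment ℝ (w + b • v) (w + c • v) ∨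
      w + b • v ∈ segment ℝ (w + a • v) (w + c • v) ∨
        w + c • v ∈ segment ℝ (w + a • v) (w + b • v) := by
  have key : ∀ x y z : ℝ, x ∈ segment ℝ y z →
      w + x • v ∈ segment ℝ (w + y • v) (w + z • v) := by
    rintro x y z ⟨s, t, hs, ht, hst, rfl⟩
    refine ⟨s, t, hs, ht, hst, ?_⟩
    obtain rfl : t = 1 - s := by linarith
    simp only [smul_eq_mul]
    module
  have h : a ∈ segment ℝ b c ∨ b ∈ segment ℝ a c ∨ c ∈ segment ℝ a b := by
    simp only [segment_eq_uIcc, Set.mem_uIcc]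
    grind
  exact h.imp (key _ _ _) (Or.imp (key _ _ _) (key _ _ _))

/-- Three convex sets with convex complements, inside a convex set with finitely many integer
points: the integer hull of the intersection is determined by the intersections of two. -/
lemma mem_integerHull_inter_three_of_finite {C A₁ A₂ A₃ : Set (EuclideanSpace ℝ (Fin 2))}
    (hC : Convex ℝ C) (hfin : (integerPoints 2 ∩ C).Finite)
    (h₁ : Convex ℝ A₁) (h₁' : Convex ℝ A₁ᶜ) (h₂ : Convex ℝ A₂) (h₂' : Convex ℝ A₂ᶜ)
    (h₃ : Convex ℝ A₃) {x : EuclideanSpace ℝ (Fin 2)}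
    (hx₁ : x ∈ integerHull (C ∩ (A₂ ∩ A₃))) (hx₂ : x ∈ integerHull (C ∩ (A₁ ∩ A₃)))
    (hx₃ : x ∈ integerHull (C ∩ (A₁ ∩ A₂))) :
    x ∈ integerHull (C ∩ (A₁ ∩ A₂ ∩ A₃)) := by
  unfold integerHull at *
  set S := C ∩ (A₁ ∩ A₂ ∩ A₃) ∩ integerPoints 2 with hS
  by_contra hx
  have hSfin : S.Finite := hfin.subset fun z hz => ⟨hz.2, hz.1.1⟩
  -- Lattice points of `C ∩ (A₂ ∩ A₃)` outside `S` avoid `A₁`, so the ray from `p` through `x` meets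
  -- `A₁ᶜ ∩ A₂` at or past `x`; likewise it meets `A₂ᶜ ∩ A₁`. The nearer of the two points lies
  -- between `p` and the other, hence in the set it should avoid.
  have hray : ∀ p ∈ A₁, p ∈ A₂ → ¬ ∀ s ∈ S, ∃ τ : ℝ, 0 ≤ τ ∧ s = p - τ • (x - p) := by
    intro p hp₁ hp₂ hp
    obtain ⟨r₁, hr₁, hz₁⟩ := exists_mem_convexHull_diff_on_ray
      (by exact fun z hz => ⟨⟨hz.1.1, hz.1.2.1.2, hz.1.2.2⟩, hz.2⟩) hx₁ hx hp
    obtain ⟨r₂, hr₂, hz₂⟩ := exists_mem_convexHull_diff_on_ray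
      (by exact fun z hz => ⟨⟨hz.1.1, hz.1.2.1.1, hz.1.2.2⟩, hz.2⟩) hx₂ hx hp
    have m₁ : p + r₁ • (x - p) ∈ A₁ᶜ ∩ A₂ := convexHull_min
      (by exact fun z hz => ⟨fun h => hz.2 ⟨⟨hz.1.1.1, ⟨h, hz.1.1.2.1⟩, hz.1.1.2.2⟩, hz.1.2⟩, hz.1.1.2.1⟩)
      (h₁'.inter h₂) hz₁
    have m₂ : p + r₂ • (x - p) ∈ A₂ᶜ ∩ A₁ := convexHull_min
      (by exact fun z hz => ⟨fun h => hz.2 ⟨⟨hz.1.1.1, ⟨hz.1.1.2.1, h⟩, hz.1.1.2.2⟩, hz.1.2⟩, hz.1.1.2.1⟩)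
      (h₂'.inter h₁) hz₂
    have key : ∀ (A : Set (EuclideanSpace ℝ (Fin 2))) (r r' : ℝ), Convex ℝ A → p ∈ A → 1 ≤ r →
        r ≤ r' → p + r' • (x - p) ∈ A → p + r • (x - p) ∈ A := by
      intro A r r' hA hpA hr hrr hA'
      have hr' : 0 < r' := by linarith
      have := hA hpA hA' (a := 1 - r / r') (b := r / r')
        (by rw [sub_nonneg, div_le_one hr']; exact hrr) (by positivity) (by ring)
      convert this using 1
      have hrr' : r = r / r' * r' := by field_simp
      generalize r / r' = k at *
      subst hrr'
      module
    rcases le_total r₁ r₂ with h | h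
    · exact m₁.1 (key A₁ r₁ r₂ h₁ hp₁ hr₁ h m₂.2)
    · exact m₂.1 (key A₂ r₂ r₁ h₂ hp₂ hr₂ h m₁.2)
  rcases S.eq_empty_or_nonempty with hemp | hne
  -- For empty `S` the ray condition is vacuous, and `p = x` serves.
  · refine hray x ?_ ?_ (by simp [hemp])
    · exact convexHull_min (fun z hz => hz.1.2.1) h₁ hx₂
    · exact convexHull_min (fun z hz => hz.1.2.1) h₂ hx₁
  rcases exists_ray_or_visible_edge hSfin hne hx with ⟨p, hpS, hp⟩ | ⟨p, hpS, q, hqS, hpos, hle⟩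
  · exact hray p hpS.1.2.1.1 hpS.1.2.1.2 hp
  have hpq : p ≠ q := by
    rintro rfl
    simp [orient] at hpos
  obtain ⟨w, v, hwv, hn⟩ := exists_first_lattice_line hpS.2 hqS.2 hpq
  have hex : ∀ K : Set (EuclideanSpace ℝ (Fin 2)), Convex ℝ K → p ∈ K → q ∈ K →
      x ∈ convexHull ℝ (K ∩ integerPoints 2) →
      ∃ t : ℝ, w + t • v ∈ integerPoints 2 ∧ w + t • v ∈ K := by
    intro K hK hpK hqK hxK
    obtain ⟨n, hnK, hnpos⟩ : ∃ n ∈ K ∩ integerPoints 2, 0 < orient p q n := by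
      by_contra hcon
      push Not at hcon
      exact absurd (convexHull_min hcon (convex_orient_nonpos p q) hxK) (not_le.2 hpos)
    obtain ⟨t, ht, ht'⟩ := hn n hnK.2 hnpos
    refine ⟨t, ht, convexHull_min ?_ hK ht'⟩
    rintro z (rfl | rfl | rfl)
    exacts [hpK, hqK, hnK.1]
  obtain ⟨⟨hpC, ⟨hp1, hp2⟩, hp3⟩, -⟩ := hpS
  obtain ⟨⟨hqC, ⟨hq1, hq2⟩, hq3⟩, -⟩ := hqS
  obtain ⟨t₁, hi₁, hC₁, h12, h13⟩ :=
    hex _ (hC.inter (h₂.inter h₃)) ⟨hpC, hp2, hp3⟩ ⟨hqC, hq2, hq3⟩ hx₁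
  obtain ⟨t₂, hi₂, hC₂, h21, h23⟩ :=
    hex _ (hC.inter (h₁.inter h₃)) ⟨hpC, hp1, hp3⟩ ⟨hqC, hq1, hq3⟩ hx₂
  obtain ⟨t₃, hi₃, hC₃, h31, h32⟩ :=
    hex _ (hC.inter (h₁.inter h₂)) ⟨hpC, hp1, hp2⟩ ⟨hqC, hq1, hq2⟩ hx₃
  have hfinal : ∀ t : ℝ, w + t • v ∉ S := fun t ht => absurd (hle _ ht) (not_le.2 (hwv t))
  rcases exists_between_of_three w v t₁ t₂ t₃ with h | h | h
  · exact hfinal t₁ ⟨⟨hC₁, ⟨h₁.segment_subset h21 h31 h, h12⟩, h13⟩, hi₁⟩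
  · exact hfinal t₂ ⟨⟨hC₂, ⟨h21, h₂.segment_subset h12 h32 h⟩, h23⟩, hi₂⟩
  · exact hfinal t₃ ⟨⟨hC₃, ⟨h31, h32⟩, h₃.segment_subset h13 h23 h⟩, hi₃⟩

/-- A point of a hull needs only finitely many of the generating points, so the finiteness
assumption of the three-set lemma can be met by cutting with a large ball. -/
lemma exists_closedBall_mem_integerHull {K : Set (EuclideanSpace ℝ (Fin 2))}
    {x : EuclideanSpace ℝ (Fin 2)} (hx : x ∈ integerHull K) :
    ∃ r : ℝ, ∀ r' ≥ r, x ∈ integerHull (Metric.closedBall 0 r' ∩ K) := by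
  unfold integerHull at hx
  rw [convexHull_eq_union_convexHull_finite_subsets] at hx
  simp only [Set.mem_iUnion] at hx
  obtain ⟨t, ht, hxt⟩ := hx
  obtain ⟨r, hr⟩ := (t.finite_toSet.isBounded).subset_closedBall 0
  exact ⟨r, fun r' hr' => convexHull_mono
    (by exact fun z hz => ⟨⟨Metric.closedBall_subset_closedBall hr' (hr hz), (ht hz).1⟩, (ht hz).2⟩) hxt⟩

lemma mem_integerHull_inter_three {C A₁ A₂ A₃ : Set (EuclideanSpace ℝ (Fin 2))}
    (hC : Convex ℝ C)
    (h₁ : Convex ℝ A₁) (h₁' : Convex ℝ A₁ᶜ) (h₂ : Convex ℝ A₂) (h₂' : Convex ℝ A₂ᶜ)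
    (h₃ : Convex ℝ A₃) {x : EuclideanSpace ℝ (Fin 2)}
    (hx₁ : x ∈ integerHull (C ∩ (A₂ ∩ A₃))) (hx₂ : x ∈ integerHull (C ∩ (A₁ ∩ A₃)))
    (hx₃ : x ∈ integerHull (C ∩ (A₁ ∩ A₂))) :
    x ∈ integerHull (C ∩ (A₁ ∩ A₂ ∩ A₃)) := by
  obtain ⟨r₁, hr₁⟩ := exists_closedBall_mem_integerHull hx₁
  obtain ⟨r₂, hr₂⟩ := exists_closedBall_mem_integerHull hx₂
  obtain ⟨r₃, hr₃⟩ := exists_closedBall_mem_integerHull hx₃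
  set r := max r₁ (max r₂ r₃)
  have h := mem_integerHull_inter_three_of_finite (C := Metric.closedBall 0 r ∩ C)
    ((convex_closedBall 0 r).inter hC)
    ((finite_integerPoints_inter_closedBall r).subset fun z hz => ⟨hz.1, hz.2.1⟩)
    h₁ h₁' h₂ h₂' h₃ (x := x)
    (by rw [Set.inter_assoc]; exact hr₁ r (le_max_left _ _))
    (by rw [Set.inter_assoc]; exact hr₂ r ((le_max_left _ _).trans (le_max_right _ _)))
    (by rw [Set.inter_assoc]; exact hr₃ r ((le_max_right _ _).trans (le_max_right _ _)))
  exact convexHull_mono (by exact fun z hz => ⟨⟨hz.1.1.2, hz.1.2⟩, hz.2⟩) h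

/-! ### From three sets to finitely many -/

/-- The integer hull of an intersection of at least two convex sets with convex complements is
determined by their pairwise intersections. -/
theorem mem_integerHull_iInter_of_pairs {ι : Type*} {I : Finset ι} (hI : 2 ≤ I.card)
    {H : ι → Set (EuclideanSpace ℝ (Fin 2))} (hH : ∀ i, Convex ℝ (H i))
    (hH' : ∀ i, Convex ℝ (H i)ᶜ) {x : EuclideanSpace ℝ (Fin 2)}
    (hx : ∀ i ∈ I, ∀ j ∈ I, i ≠ j → x ∈ integerHull (H i ∩ H j)) :
    x ∈ integerHull (⋂ i ∈ I, H i) := by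
  classical
  suffices h : ∀ J ⊆ I, x ∈ integerHull (⋂ i ∈ J, H i) from h I subset_rfl
  intro J
  induction J using Finset.strongInduction with
  | H J ih =>
  intro hJI
  rcases le_or_gt J.card 2 with hJ | hJ
  -- Enlarging `J` to a pair inside `I` only shrinks the hull, so the hypothesis on pairs also
  -- covers fewer than two sets.
  · obtain ⟨J', hJJ', hJ'I, hJ'⟩ := Finset.exists_subsuperset_card_eq hJI hJ hI
    obtain ⟨i, j, hij, rfl⟩ := Finset.card_eq_two.1 hJ'
    refine convexHull_mono ?_ (hx i (hJ'I (by simp)) j (hJ'I (by simp)) hij)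
    rintro z ⟨⟨hzi, hzj⟩, hz⟩
    refine ⟨Set.mem_iInter₂.2 fun k hk => ?_, hz⟩
    have := hJJ' hk
    simp only [Finset.mem_insert, Finset.mem_singleton] at this
    rcases this with rfl | rfl
    exacts [hzi, hzj]
  · obtain ⟨i, j, k, hi, hj, hk, hij, hik, hjk⟩ := Finset.two_lt_card_iff.1 hJ
    have herase : ∀ l ∈ J, x ∈ integerHull (⋂ i ∈ J.erase l, H i) := fun l hl =>
      ih _ (Finset.erase_ssubset hl) ((Finset.erase_subset _ _).trans hJI)
    have hCconv : Convex ℝ (⋂ l ∈ J \ {i, j, k}, H l) := convex_iInter₂ fun l _ => hH l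
    have h := mem_integerHull_inter_three hCconv (hH i) (hH' i) (hH j) (hH' j) (hH k)
      (x := x) ?_ ?_ ?_
    · refine convexHull_mono (Set.inter_subset_inter_left _ ?_) h
      rintro z ⟨hzC, ⟨hzi, hzj⟩, hzk⟩
      simp only [Set.mem_iInter, Finset.mem_sdiff, Finset.mem_insert, Finset.mem_singleton] at *
      intro l hl
      by_cases h1 : l = i ∨ l = j ∨ l = k
      · rcases h1 with rfl | rfl | rfl <;> assumption
      · exact hzC l ⟨hl, h1⟩
    · refine convexHull_mono (Set.inter_subset_inter_left _ ?_) (herase i hi)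
      intro z hz
      simp only [Set.mem_iInter, Finset.mem_erase] at hz
      refine ⟨?_, hz j ⟨hij.symm, hj⟩, hz k ⟨hik.symm, hk⟩⟩
      simp only [Set.mem_iInter, Finset.mem_sdiff, Finset.mem_insert, Finset.mem_singleton]
      exact fun l hl => hz l ⟨fun h => hl.2 (Or.inl h), hl.1⟩
    · refine convexHull_mono (Set.inter_subset_inter_left _ ?_) (herase j hj)
      intro z hz
      simp only [Set.mem_iInter, Finset.mem_erase] at hz
      refine ⟨?_, hz i ⟨hij, hi⟩, hz k ⟨hjk.symm, hk⟩⟩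
      simp only [Set.mem_iInter, Finset.mem_sdiff, Finset.mem_insert, Finset.mem_singleton]
      exact fun l hl => hz l ⟨fun h => hl.2 (Or.inr (Or.inl h)), hl.1⟩
    · refine convexHull_mono (Set.inter_subset_inter_left _ ?_) (herase k hk)
      intro z hz
      simp only [Set.mem_iInter, Finset.mem_erase] at hz
      refine ⟨?_, hz i ⟨hik, hi⟩, hz j ⟨hjk, hj⟩⟩
      simp only [Set.mem_iInter, Finset.mem_sdiff, Finset.mem_insert, Finset.mem_singleton]
      exact fun l hl => hz l ⟨fun h => hl.2 (Or.inr (Or.inr h)), hl.1⟩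

/-! ### Lines, half-planes and facets in the plane -/

lemma inner_fin_two (a x : EuclideanSpace ℝ (Fin 2)) : inner ℝ a x = a 0 * x 0 + a 1 * x 1 := by
  rw [PiLp.inner_apply, Fin.sum_univ_two]
  simp [mul_comm]

lemma integerHull_univ : integerHull (Set.univ : Set (EuclideanSpace ℝ (Fin 2))) = Set.univ := by
  rw [Set.eq_univ_iff_forall]
  intro x
  have hconv : Convex ℝ (integerHull (Set.univ : Set (EuclideanSpace ℝ (Fin 2)))) :=
    convex_convexHull ℝ _
  have hint : ∀ k l : ℤ, !₂[(k : ℝ), (l : ℝ)] ∈ integerHull Set.univ := by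
    intro k l
    apply subset_convexHull
    refine ⟨trivial, fun i => ?_⟩
    fin_cases i
    exacts [⟨k, rfl⟩, ⟨l, rfl⟩]
  have hrow : ∀ l : ℤ, !₂[x 0, (l : ℝ)] ∈ integerHull Set.univ := by
    intro l
    convert hconv (hint ⌊x 0⌋ l) (hint (⌊x 0⌋ + 1) l) (a := 1 - Int.fract (x 0))
      (b := Int.fract (x 0)) (by linarith [Int.fract_lt_one (x 0)]) (Int.fract_nonneg _)
      (by ring) using 1
    have := Int.floor_add_fract (x 0)
    ext i
    fin_cases i
    · simp; linarith
    · simp; ring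
  convert hconv (hrow ⌊x 1⌋) (hrow (⌊x 1⌋ + 1)) (a := 1 - Int.fract (x 1))
    (b := Int.fract (x 1)) (by linarith [Int.fract_lt_one (x 1)]) (Int.fract_nonneg _)
    (by ring) using 1
  have := Int.floor_add_fract (x 1)
  ext i
  fin_cases i
  · simp; ring
  · simp; linarith

lemma convex_halfspace {n : ℕ} (a : EuclideanSpace ℝ (Fin n)) (b : ℝ) :
    Convex ℝ {x | inner ℝ a x ≤ b} :=
  convex_halfSpace_le (innerSL ℝ a).isLinear b

lemma convex_compl_halfspace {n : ℕ} (a : EuclideanSpace ℝ (Fin n)) (b : ℝ) :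
    Convex ℝ {x | inner ℝ a x ≤ b}ᶜ := by
  have : {x | inner ℝ a x ≤ b}ᶜ = {x | b < inner ℝ a x} := by ext; simp
  rw [this]
  exact convex_halfSpace_gt (innerSL ℝ a).isLinear b

/-- In the plane, the vectors orthogonal to `a ≠ 0` are the multiples of `a` turned by a right
angle. -/
lemma mem_span_rotate_of_inner_eq_zero {a x : EuclideanSpace ℝ (Fin 2)} (ha : a ≠ 0)
    (h : inner ℝ a x = 0) : x ∈ Submodule.span ℝ {!₂[-a 1, a 0]} := by
  rw [inner_fin_two] at h
  have hpos : a 0 ^ 2 + a 1 ^ 2 ≠ 0 := by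
    intro hcon
    apply ha
    ext i
    fin_cases i
    · simp; nlinarith [sq_nonneg (a 0), sq_nonneg (a 1)]
    · simp; nlinarith [sq_nonneg (a 0), sq_nonneg (a 1)]
  rw [Submodule.mem_span_singleton]
  refine ⟨(a 0 * x 1 - a 1 * x 0) / (a 0 ^ 2 + a 1 ^ 2), ?_⟩
  ext i
  fin_cases i
  · simp
    field_simp
    linear_combination (-a 0) * h
  · simp
    field_simp
    linear_combination (-a 1) * h

lemma rotate_ne_zero {a : EuclideanSpace ℝ (Fin 2)} (ha : a ≠ 0) : !₂[-a 1, a 0] ≠ 0 := by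
  intro h
  apply ha
  have h0 := congrArg (fun z : EuclideanSpace ℝ (Fin 2) => z 0) h
  have h1 := congrArg (fun z : EuclideanSpace ℝ (Fin 2) => z 1) h
  simp at h0 h1
  ext i
  fin_cases i <;> simp [h0, h1]

/-- A planar set inside a line spans at most a line. -/
lemma vectorSpan_le_of_subset_line {a : EuclideanSpace ℝ (Fin 2)} (ha : a ≠ 0) {b : ℝ}
    {F : Set (EuclideanSpace ℝ (Fin 2))} (hF : F ⊆ {x | inner ℝ a x = b}) :
    vectorSpan ℝ F ≤ Submodule.span ℝ {!₂[-a 1, a 0]} := by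
  rw [vectorSpan_def, Submodule.span_le]
  rintro _ ⟨y, hy, z, hz, rfl⟩
  have hy' : inner ℝ a y = b := hF hy
  have hz' : inner ℝ a z = b := hF hz
  exact mem_span_rotate_of_inner_eq_zero ha (by simp [inner_sub_right, hy', hz'])

lemma dimension_le_one_of_subset_line {a : EuclideanSpace ℝ (Fin 2)} (ha : a ≠ 0) {b : ℝ}
    {F : Set (EuclideanSpace ℝ (Fin 2))} (hF : F ⊆ {x | inner ℝ a x = b}) :
    dimension F ≤ 1 :=
  (Submodule.finrank_mono (vectorSpan_le_of_subset_line ha hF)).trans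
    (finrank_span_singleton (rotate_ne_zero ha)).le

/-- Two facet-defining half-planes of different facets meet in a simplicial cone or a strip. -/
lemma isSimplicialCone_or_isStrip {P Q : Set (EuclideanSpace ℝ (Fin 2))} (hdim : dimension P = 2)
    (hQ : Q ∈ facetPairRelaxations P) : IsSimplicialCone Q ∨ IsStrip Q := by
  obtain ⟨F₁, F₂, H₁, H₂, ⟨-, hne₁, -⟩, ⟨-, hne₂, -⟩, hne, ⟨a₁, b₁, ha₁, hH₁, hP₁, hF₁⟩,
    ⟨a₂, b₂, ha₂, hH₂, hP₂, hF₂⟩, rfl⟩ := hQ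
  by_cases hli : LinearIndependent ℝ ![a₁, a₂]
  · left
    refine ⟨![a₁, a₂], ![b₁, b₂], hli, ?_⟩
    ext x
    simp [hH₁, hH₂, Fin.forall_fin_two]
  right
  rw [LinearIndependent.pair_iff' ha₁] at hli
  push Not at hli
  obtain ⟨c, rfl⟩ := hli
  have hc : c ≠ 0 := by
    rintro rfl
    simp at ha₂
  rw [hF₁] at hne₁
  rw [hF₂] at hne₂
  obtain ⟨y₁, hy₁P, hy₁⟩ := hne₁
  obtain ⟨y₂, hy₂P, hy₂⟩ := hne₂
  have hle₁ : ∀ y ∈ P, inner ℝ a₁ y ≤ b₁ := fun y hy => by have := hP₁ hy; rwa [hH₁] at this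
  have hle₂ : ∀ y ∈ P, c * inner ℝ a₁ y ≤ b₂ := fun y hy => by
    have := hP₂ hy
    rw [hH₂] at this
    simpa [inner_smul_left] using this
  have hy₁' : inner ℝ a₁ y₁ = b₁ := hy₁
  have hy₂' : c * inner ℝ a₁ y₂ = b₂ := by simpa [inner_smul_left] using hy₂
  -- Opposite normals give a strip, of positive width since otherwise `P` would lie on a line.
  -- Normals of equal direction give a single line, as both bounds are attained on `P`, and then the
  -- facets coincide.
  rcases lt_or_gt_of_ne hc with hneg | hpos
  · refine ⟨a₁, b₂ / c, b₁, ha₁, ?_, ?_⟩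
    · by_contra hcon
      push Not at hcon
      have : dimension P ≤ 1 := by
        refine dimension_le_one_of_subset_line ha₁ (b := b₁) fun y hy => ?_
        have h1 := hle₁ y hy
        have h2 := hle₂ y hy
        have h3 : b₂ / c ≤ inner ℝ a₁ y := by rw [div_le_iff_of_neg hneg]; linarith
        exact le_antisymm h1 (hcon.trans h3)
      omega
    · ext x
      simp only [hH₁, hH₂, Set.mem_inter_iff, Set.mem_ofPred_eq, inner_smul_left,
        div_le_iff_of_neg hneg]
      simp only [conj_trivial, mul_comm c]
      tauto
  · exfalso
    apply hne
    have hb : b₂ = c * b₁ := by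
      have h1 := hle₂ y₁ hy₁P
      have h2 := hle₁ y₂ hy₂P
      rw [hy₁'] at h1
      nlinarith
    rw [hF₁, hF₂]
    ext y
    simp [inner_smul_left, hb, hc]

lemma interior_nonempty_of_dimension_eq {n : ℕ} (hn : n ≠ 0)
    {P : Set (EuclideanSpace ℝ (Fin n))} (hP : Convex ℝ P) (hdim : dimension P = n) :
    (interior P).Nonempty := by
  have hne : P.Nonempty := by
    rw [Set.nonempty_iff_ne_empty]
    rintro rfl
    rw [dimension, vectorSpan_empty, finrank_bot] at hdim
    exact hn hdim.symm
  rw [hP.interior_nonempty_iff_affineSpan_eq_top,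
    AffineSubspace.affineSpan_eq_top_iff_vectorSpan_eq_top_of_nonempty _ _ _ hne]
  apply Submodule.eq_top_of_finrank_eq
  rw [finrank_euclideanSpace_fin]
  exact hdim

lemma inner_lt_of_mem_interior {n : ℕ} {P : Set (EuclideanSpace ℝ (Fin n))}
    {a z : EuclideanSpace ℝ (Fin n)} {b : ℝ} (ha : a ≠ 0) (hP : ∀ y ∈ P, inner ℝ a y ≤ b)
    (hz : z ∈ interior P) : inner ℝ a z < b := by
  have hcont : Filter.Tendsto (fun t : ℝ => z + t • a) (nhdsWithin 0 (Set.Ioi 0)) (nhds z) := by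
    have : Continuous fun t : ℝ => z + t • a := by fun_prop
    have h := this.tendsto 0
    simp only [zero_smul, add_zero] at h
    exact h.mono_left nhdsWithin_le_nhds
  have hev := hcont.eventually (mem_interior_iff_mem_nhds.1 hz)
  obtain ⟨t, ht, ht0⟩ := (hev.and self_mem_nhdsWithin).exists
  have h1 := hP _ ht
  rw [inner_add_right, inner_smul_right] at h1
  have h2 : 0 < inner ℝ a a := real_inner_self_pos.2 ha
  have h3 : (0 : ℝ) < t := ht0
  nlinarith [mul_pos h3 h2]

/-- An irredundant row of a description of a full-dimensional planar polyhedron defines a facet,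
with a point at which all other rows are slack. -/
lemma isFacet_of_irredundant {ι : Type*} [DecidableEq ι] {I : Finset ι}
    {a : ι → EuclideanSpace ℝ (Fin 2)}
    {b : ι → ℝ} {P : Set (EuclideanSpace ℝ (Fin 2))} (hdim : dimension P = 2)
    (hP : P = ⋂ i ∈ I, {x | inner ℝ (a i) x ≤ b i}) (ha : ∀ i ∈ I, a i ≠ 0) {i : ι} (hi : i ∈ I)
    (hirr : ¬ (⋂ j ∈ I.erase i, {x | inner ℝ (a j) x ≤ b j}) ⊆ P) :
    IsFacet P (P ∩ {x | inner ℝ (a i) x = b i}) ∧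
      ∃ w ∈ P ∩ {x | inner ℝ (a i) x = b i}, ∀ j ∈ I, j ≠ i → inner ℝ (a j) w < b j := by
  have hmem : ∀ y, y ∈ P ↔ ∀ j ∈ I, inner ℝ (a j) y ≤ b j := by
    intro y; rw [hP]; simp
  have hconv : Convex ℝ P := by
    rw [hP]; exact convex_iInter₂ fun j _ => convex_halfspace _ _
  obtain ⟨z, hz⟩ := interior_nonempty_of_dimension_eq two_ne_zero hconv hdim
  have hzlt : ∀ j ∈ I, inner ℝ (a j) z < b j := fun j hj =>
    inner_lt_of_mem_interior (ha j hj) (fun y hy => (hmem y).1 hy j hj) hz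
  obtain ⟨y, hy, hyP⟩ := Set.not_subset.1 hirr
  simp only [Set.mem_iInter, Finset.mem_erase, Set.mem_ofPred_eq, and_imp] at hy
  have hyi : b i < inner ℝ (a i) y := by
    by_contra hcon
    push Not at hcon
    refine hyP ((hmem y).2 fun j hj => ?_)
    by_cases hji : j = i
    · rw [hji]; exact hcon
    · exact hy j hji hj
  -- The segment from the interior point `z` to `y`, which violates row `i` alone, crosses the line
  -- of row `i` at `w`, where the other rows are still slack.
  set k : ℝ := (b i - inner ℝ (a i) z) / (inner ℝ (a i) y - inner ℝ (a i) z) with hk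
  have hzi := hzlt i hi
  have hden : 0 < inner ℝ (a i) y - inner ℝ (a i) z := by linarith
  have hk0 : 0 ≤ k := div_nonneg (by linarith) hden.le
  have hk1 : k < 1 := by rw [hk, div_lt_one hden]; linarith
  set w := z + k • (y - z) with hw
  have hwi : inner ℝ (a i) w = b i := by
    rw [hw, inner_add_right, inner_smul_right, inner_sub_right, hk, div_mul_cancel₀ _ hden.ne']
    ring
  have hwj : ∀ j ∈ I, j ≠ i → inner ℝ (a j) w < b j := by
    intro j hj hji
    rw [hw, inner_add_right, inner_smul_right, inner_sub_right]
    nlinarith [hzlt j hj, hy j hji hj]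
  have hwP : w ∈ P := (hmem w).2 fun j hj => by
    by_cases hji : j = i
    · rw [hji]; exact hwi.le
    · exact (hwj j hj hji).le
  refine ⟨⟨?_, ⟨w, hwP, hwi⟩, ?_⟩, w, ⟨hwP, hwi⟩, hwj⟩
  · refine fun _ => ⟨innerSL ℝ (a i), ?_⟩
    ext v
    constructor
    · rintro ⟨hv, hvi⟩
      refine ⟨hv, fun u hu => ?_⟩
      simp only [innerSL_apply_apply]
      rw [show inner ℝ (a i) v = b i from hvi]
      exact (hmem u).1 hu i hi
    · rintro ⟨hv, hvi⟩
      refine ⟨hv, le_antisymm ((hmem v).1 hv i hi) ?_⟩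
      have := hvi w hwP
      simp only [innerSL_apply_apply] at this
      rwa [hwi] at this
  -- Slackness at `w` leaves room to move along the line inside `P`; the second point so obtained
  -- gives the face dimension one.
  · set d : EuclideanSpace ℝ (Fin 2) := !₂[-a i 1, a i 0] with hd
    have hd0 : d ≠ 0 := rotate_ne_zero (ha i hi)
    have hdi : inner ℝ (a i) d = 0 := by rw [inner_fin_two]; simp [hd]; ring
    have hev : ∀ᶠ t in nhdsWithin (0 : ℝ) (Set.Ioi 0), ∀ j ∈ I, j ≠ i →
        inner ℝ (a j) (w + t • d) < b j := by
      rw [Filter.eventually_all_finset]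
      intro j hj
      by_cases hji : j = i
      · simp [hji]
      have hcont : Continuous fun t : ℝ => inner ℝ (a j) (w + t • d) := by fun_prop
      have h := hcont.tendsto 0
      simp only [zero_smul, add_zero] at h
      filter_upwards [nhdsWithin_le_nhds (h.eventually_lt_const (hwj j hj hji))] with t ht _
      exact ht
    obtain ⟨t, ht, ht0⟩ := (hev.and self_mem_nhdsWithin).exists
    have ht0 : (0 : ℝ) < t := ht0
    have hwt : inner ℝ (a i) (w + t • d) = b i := by
      rw [inner_add_right, inner_smul_right, hdi, hwi]; ring
    have hwtP : w + t • d ∈ P := (hmem _).2 fun j hj => by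
      by_cases hji : j = i
      · rw [hji]; exact hwt.le
      · exact (ht j hj hji).le
    have hspan : vectorSpan ℝ (P ∩ {x | inner ℝ (a i) x = b i}) = Submodule.span ℝ {d} := by
      apply le_antisymm (vectorSpan_le_of_subset_line (ha i hi) Set.inter_subset_right)
      rw [Submodule.span_singleton_le_iff_mem]
      have := vsub_mem_vectorSpan ℝ (s := P ∩ {x | inner ℝ (a i) x = b i})
        (p₁ := w + t • d) (p₂ := w) ⟨hwtP, hwt⟩ ⟨hwP, hwi⟩
      rw [vsub_eq_sub, add_sub_cancel_left] at this
      exact (Submodule.smul_mem_iff _ ht0.ne').1 this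
    rw [hdim, dimension, hspan, finrank_span_singleton hd0]

theorem exists_irredundant_rows {n : ℕ} {P : Set (EuclideanSpace ℝ (Fin n))}
    (hne : P.Nonempty) (hrat : IsRationalPolyhedron P) :
    ∃ (m : ℕ) (a : Fin m → EuclideanSpace ℝ (Fin n)) (b : Fin m → ℝ) (I : Finset (Fin m)),
      P = (⋂ i ∈ I, {x | inner ℝ (a i) x ≤ b i}) ∧ (∀ i ∈ I, a i ≠ 0) ∧
      ∀ i ∈ I, ¬ (⋂ j ∈ I.erase i, {x | inner ℝ (a j) x ≤ b j}) ⊆ P := by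
  obtain ⟨m, A, b, hA⟩ := hrat
  set a : Fin m → EuclideanSpace ℝ (Fin n) := fun i => WithLp.toLp 2 fun j => (A i j : ℝ)
  have hPa : P = ⋂ i ∈ (Finset.univ : Finset (Fin m)), {x | inner ℝ (a i) x ≤ b i} := by
    rw [hA]
    ext x
    simp [a, PiLp.inner_apply, mul_comm]
  obtain ⟨I, hI⟩ := Set.Finite.exists_minimal
    (Set.toFinite {J : Finset (Fin m) | P = ⋂ i ∈ J, {x | inner ℝ (a i) x ≤ b i}}) ⟨_, hPa⟩
  have hirr : ∀ i ∈ I, ¬ (⋂ j ∈ I.erase i, {x | inner ℝ (a j) x ≤ b j}) ⊆ P := by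
    intro i hi hsub
    have hP : P = ⋂ j ∈ I.erase i, {x | inner ℝ (a j) x ≤ (b j : ℝ)} := by
      refine Set.Subset.antisymm ?_ hsub
      rw [show P = _ from hI.prop]
      exact Set.biInter_subset_biInter_left (Finset.erase_subset i I)
    exact Finset.notMem_erase i I (hI.le_of_le hP (Finset.erase_subset i I) hi)
  -- A row with zero normal that holds at one point of `P` holds everywhere, so it would be
  -- redundant.
  refine ⟨m, a, fun i => b i, I, hI.prop, fun i hi hai => hirr i hi fun y hy => ?_, hirr⟩
  obtain ⟨p, hp⟩ := hne
  rw [show P = _ from hI.prop] at hp ⊢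
  simp only [Set.mem_iInter, Set.mem_ofPred_eq, Finset.mem_erase, and_imp] at hp hy ⊢
  intro j hj
  by_cases hji : j = i
  · have := hp i hi
    rw [hji]
    rw [hai, inner_zero_left] at this ⊢
    exact this
  · exact hy j hji hj

end PlaneHull

theorem mainTheorem7 (P : Set (EuclideanSpace ℝ (Fin 2)))
    (hrat : PlaneHull.IsRationalPolyhedron P) (hdim : PlaneHull.dimension P = 2)
    (hhalf : ¬ PlaneHull.IsHalfspace P) :
    (∀ Q ∈ PlaneHull.facetPairRelaxations P,
      PlaneHull.IsSimplicialCone Q ∨ PlaneHull.IsStrip Q) ∧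
    PlaneHull.integerHull P =
      ⋂ Q ∈ PlaneHull.facetPairRelaxations P, PlaneHull.integerHull Q := by
  refine ⟨fun Q hQ => PlaneHull.isSimplicialCone_or_isStrip hdim hQ, ?_⟩
  apply Set.Subset.antisymm
  · refine Set.subset_iInter₂ ?_
    rintro _ ⟨F₁, F₂, H₁, H₂, -, -, -, ⟨_, _, _, _, h₁, _⟩, ⟨_, _, _, _, h₂, _⟩, rfl⟩
    exact convexHull_mono (Set.inter_subset_inter_left _ (Set.subset_inter h₁ h₂))
  -- The empty set has dimension `0` by convention, not two.
  have hne : P.Nonempty := by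
    rw [Set.nonempty_iff_ne_empty]
    rintro rfl
    rw [PlaneHull.dimension, vectorSpan_empty, finrank_bot] at hdim
    omega
  obtain ⟨m, a, b, I, hP, ha, hirr⟩ := PlaneHull.exists_irredundant_rows hne hrat
  rcases lt_or_ge I.card 2 with hI | hI
  · rcases Nat.le_one_iff_eq_zero_or_eq_one.1 (Nat.lt_succ_iff.1 hI) with hI | hI
    · rw [Finset.card_eq_zero] at hI
      have : P = Set.univ := by rw [hP, hI]; simp
      rw [this, PlaneHull.integerHull_univ]
      exact Set.subset_univ _
    · obtain ⟨i, rfl⟩ := Finset.card_eq_one.1 hI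
      exact absurd ⟨a i, b i, ha i (by simp), by rw [hP]; simp⟩ hhalf
  intro x hx
  rw [Set.mem_iInter₂] at hx
  rw [hP]
  refine PlaneHull.mem_integerHull_iInter_of_pairs hI (fun i => PlaneHull.convex_halfspace _ _)
    (fun i => PlaneHull.convex_compl_halfspace _ _) fun i hi j hj hij => hx _ ?_
  obtain ⟨hFi, w, hwi, hw⟩ := PlaneHull.isFacet_of_irredundant hdim hP ha hi (hirr i hi)
  obtain ⟨hFj, -⟩ := PlaneHull.isFacet_of_irredundant hdim hP ha hj (hirr j hj)
  have hsub : ∀ k ∈ I, P ⊆ {x | inner ℝ (a k) x ≤ b k} := by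
    intro k hk
    rw [hP]
    exact Set.biInter_subset_of_mem hk
  refine ⟨_, _, _, _, hFi, hFj, fun heq => ?_, ⟨a i, b i, ha i hi, rfl, hsub i hi, rfl⟩,
    ⟨a j, b j, ha j hj, rfl, hsub j hj, rfl⟩, rfl⟩
  -- `w` is on the line of row `i` but strictly inside row `j`, so the two facets differ.
  rw [heq] at hwi
  exact (hw j hj hij.symm).ne hwi.2
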